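/- **Theorem (Generic reconstruction for the higher Prony system).** Fix integers $d\ge 0$ and $n\ge d+1$. Let $$P=\{(x,\alpha)\in\mathbb R^{n}\times\mathbb R^{n-d}: x_1,\dots,x_n \text{ pairwise distinct},\ \alpha_i\neq 0 \text{ for all } i\}$$ and define the higher Prony map $(x,\alpha)\mapsto M=(m_0,\dots,m_{2n-d-1})$ by $$\sum_{i=1}^{n-d}\alpha_i\,h_j(x_i,x_{i+1},\dots,x_{i+d})=\binom{j+d}{d}m_j ,\qquad j=0,\dots,2n-d-1,$$ where $h_j$ is the complete homogeneous symmetric polynomial of degree $j$. For $M=(m_0,\dots,m_{2n-d-1})\in\mathbb R^{2n-d}$ put $c_0=\dots=c_{d-1}=0$, $c_{d+i}=\binom{i+d}{d}m_i$ for $0\le i\le 2n-d-1$, let $H_M=(c_{i+j})_{0\le i\le n-1,\,0\le j\le n}$ and $b(M)=\bigl(\binom{r+d}{d}m_r\bigr)_{0\le r\le n-d-1}$. For $x\in\mathbb R^n$ put $A_{d,n}(x)=\bigl(h_r(x_i,\dots,x_{i+d})\bigr)_{0\le r\le n-d-1,\ 1\le i\le n-d}$. If $\ker H_M$ is one-dimensional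 and spanned by $u=(u_0,\dots,u_n)$, the kernel polynomial is $p_M(t)=u_nt^n+\dots+u_1t+u_0$ (unique up to a nonzero scalar). **(1) Generic injectivity and reconstruction.** There is a subset $U\subseteq P$, Zariski open and Zariski dense in $P$, such that: * the higher Prony map is injective on $\{(x,\alpha)\in U: x_1<\dots<x_n\}$; moreover, if two points $(x,\alpha),(x',\alpha')$ of $U$ have the same image, then $x'$ is a permutation of $x$, and if $x'=x$ then $\alpha'=\alpha$; * for every $(x,\alpha)\in U$ with image $M$: the kernel of $H_M$ is one-dimensional; the kernel polynomial $p_M$ has degree $n$ and its roots are exactly $x_1,\dots,x_n$ (all simple); the matrix $A_{d,n}(x)$ is invertible and $\alpha$ is the unique solution of the linear system $A_{d,n}(x)\,\alpha=b(M)$. **(2) Positivity.** For $x_1<\dots<x_n$ and $1\le i\le n-d$ let $\mu_i$ be the normalized simplex spline with knots $x_i,\dots,x_{i+d}$, i.e. the pushforward to the line of Lebesgue measure on a $d$-simplex of volume one under a linear projection that maps its vertices to $x_i,\dots,x_{i+d}$ (the point mass at $x_i$ if $d=0$). Let $L_{d,x}$ be the real span of $\mu_1,\dots,\mu_{n-d}$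 in the space of signed measures, and let $\widetilde L^+_{d,x}=\{\sum_i\alpha_i\mu_i:\alpha_i\ge0\}$ be the positive simplicial spline cone. Let $M\in\mathbb R^{2n-d}$ be such that $\ker H_M$ is one-dimensional and $p_M$ has $n$ simple real roots $x_1<\dots<x_n$. Then $A_{d,n}(x)$ is invertible and, with $\alpha(M)=A_{d,n}(x)^{-1}b(M)$, the measure $\nu_M=\sum_i\alpha(M)_i\,\mu_i$ is the unique element of $L_{d,x}$ with $\int t^j\,d\nu_M=m_j$ for $0\le j\le 2n-d-1$; and $\nu_M\in\widetilde L^+_{d,x}$ if and only if the $n-d$ inequalities $$e_i^{T}A_{d,n}(x)^{-1}b(M)\ \ge\ 0,\qquad i=1,\dots,n-d,$$ hold. -/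

import Mathlib

open MeasureTheory ProbabilityTheory Topology

noncomputable section

namespace HigherProny

/-! ### The Zariski topology on real affine space -/

/-- The Zariski topology on `ℝ^σ`: the closed sets are the real zero loci of ideals of
`ℝ[X_s : s ∈ σ]`. -/
@[reducible]
def zariskiTopology (σ : Type*) : TopologicalSpace (σ → ℝ) :=
  TopologicalSpace.ofClosed
    {Z | ∃ I : Ideal (MvPolynomial σ ℝ), Z = MvPolynomial.zeroLocus ℝ I}
    ⟨⊤, by simp⟩
    (by
      intro A hA
      refine ⟨Ideal.span {p | ∃ Z ∈ A, ∀ x ∈ Z, MvPolynomial.aeval x p = 0}, ?_⟩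
      rw [MvPolynomial.zeroLocus_span]
      ext x
      simp only [Set.mem_sInter, Set.mem_ofPred_eq]
      constructor
      · rintro hx p ⟨Z, hZ, hp⟩
        exact hp x (hx Z hZ)
      · intro hx Z hZ
        obtain ⟨I, rfl⟩ := hA hZ
        intro p hp
        exact hx p ⟨_, hZ, fun y hy => hy p hp⟩)
    (by
      rintro _ ⟨I, rfl⟩ _ ⟨J, rfl⟩
      refine ⟨I * J, Set.ext fun x => ?_⟩
      rw [Set.mem_union]
      simp only [MvPolynomial.mem_zeroLocus_iff]
      constructor
      · intro hx p hp
        rcases hx with hx | hx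
        · exact hx p (Ideal.mul_le_left (I := I) (J := J) hp)
        · exact hx p (Ideal.mul_le_right (I := I) (J := J) hp)
      · intro hx
        by_contra hcon
        rw [not_or, not_forall, not_forall] at hcon
        obtain ⟨⟨p, hp⟩, ⟨q, hq⟩⟩ := hcon
        rw [Classical.not_imp] at hp hq
        have h := hx (p * q) (Ideal.mul_mem_mul hp.1 hq.1)
        rw [map_mul] at h
        exact mul_ne_zero hp.2 hq.2 h)

/-! ### Parameters and the higher Prony map -/

/-- Tuples `(x_1, …, x_n; α_1, …, α_{n-d})`, as points of the affine space of dimension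
`n + (n - d)`. -/
abbrev Params (d n : ℕ) : Type := (Fin n ⊕ Fin (n - d)) → ℝ

/-- The nodes `x_1, …, x_n`. -/
def nodes {d n : ℕ} (θ : Params d n) : Fin n → ℝ := fun i => θ (Sum.inl i)

/-- The amplitudes `α_1, …, α_{n-d}`. -/
def amps {d n : ℕ} (θ : Params d n) : Fin (n - d) → ℝ := fun i => θ (Sum.inr i)

/-- The parameter space: distinct real nodes and nonzero amplitudes. -/
def paramSpace (d n : ℕ) : Set (Params d n) :=
  {θ | Function.Injective (nodes θ) ∧ ∀ i, amps θ i ≠ 0}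

/-- The window `(x_i, x_{i+1}, …, x_{i+d})` of consecutive nodes. -/
def window {d n : ℕ} (x : Fin n → ℝ) (i : Fin (n - d)) : Fin (d + 1) → ℝ :=
  fun k => x ⟨i.1 + k.1, by omega⟩

/-- The value `h_j(y_0, …, y_d)` of the complete homogeneous symmetric polynomial. -/
def hval {d : ℕ} (j : ℕ) (y : Fin (d + 1) → ℝ) : ℝ :=
  MvPolynomial.eval y (MvPolynomial.hsymm (Fin (d + 1)) ℝ j)

/-- The higher Prony map: `m_j` is given by
`∑ i, α_i h_j(x_i, …, x_{i+d}) = binom(j+d, d) m_j` for `0 ≤ j ≤ 2n-d-1`. -/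
def pronyMap (d n : ℕ) (θ : Params d n) : Fin (2 * n - d) → ℝ := fun j =>
  (∑ i : Fin (n - d), amps θ i * hval j.1 (window (nodes θ) i)) / ((j.1 + d).choose d : ℝ)

/-! ### The reconstruction data -/

/-- The normalized sequence `c_0, …, c_{2n-1}`: `c_k = 0` for `k < d` and
`c_{d+i} = binom(i+d, d) m_i`. -/
def normalized {d n : ℕ} (M : Fin (2 * n - d) → ℝ) (k : Fin (2 * n)) : ℝ :=
  if h : k.1 < d then 0 else (k.1.choose d : ℝ) * M ⟨k.1 - d, by omega⟩

/-- The rectangular Hankel matrix `H_M = (c_{i+j})`, `0 ≤ i ≤ n-1`, `0 ≤ j ≤ n`. -/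
def hankel {d n : ℕ} (M : Fin (2 * n - d) → ℝ) : Matrix (Fin n) (Fin (n + 1)) ℝ :=
  Matrix.of fun i j => normalized M ⟨i.1 + j.1, by omega⟩

/-- The kernel `{u ∈ ℝ^{n+1} : H_M u = 0}`. -/
def hankelKer {d n : ℕ} (M : Fin (2 * n - d) → ℝ) : Submodule ℝ (Fin (n + 1) → ℝ) :=
  LinearMap.ker (hankel M).mulVecLin

/-- The polynomial `u_n t^n + … + u_1 t + u_0`. -/
def kernelPoly {n : ℕ} (u : Fin (n + 1) → ℝ) : Polynomial ℝ :=
  ∑ j : Fin (n + 1), Polynomial.C (u j) * Polynomial.X ^ j.1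

/-- The matrix `A_{d,n}(x) = (h_r(x_i, …, x_{i+d}))` with row index `r = 0, …, n-d-1` and
column index `i = 1, …, n-d`. -/
def ampMatrix (d : ℕ) {n : ℕ} (x : Fin n → ℝ) : Matrix (Fin (n - d)) (Fin (n - d)) ℝ :=
  Matrix.of fun r i => hval r.1 (window x i)

/-- The vector `b(M) = (binom(r+d, d) m_r)`, `r = 0, …, n-d-1`. -/
def rhs {d n : ℕ} (M : Fin (2 * n - d) → ℝ) : Fin (n - d) → ℝ := fun r =>
  ((r.1 + d).choose d : ℝ) * M ⟨r.1, by omega⟩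

/-! ### Simplex splines and the positive simplicial spline cone -/

/-- The corner simplex with vertices `0, e_1, …, e_d` in `ℝ^d`. -/
def cornerSimplex (d : ℕ) : Set (Fin d → ℝ) :=
  {u | (∀ k, 0 ≤ u k) ∧ ∑ k, u k ≤ 1}

/-- The affine function on `ℝ^d` with value `y_0` at `0` and value `y_k` at `e_k`. -/
def affineWithValues {d : ℕ} (y : Fin (d + 1) → ℝ) (u : Fin d → ℝ) : ℝ :=
  (1 - ∑ k, u k) * y 0 + ∑ k : Fin d, u k * y k.succ

/-- The normalized simplex spline (B-spline measure) with knots `y_0, …, y_d`: the pushforward to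
the line of normalized Lebesgue measure on a `d`-simplex, under a linear projection that sends its
vertices to `y_0, …, y_d`. By affine invariance it does not depend on the simplex (any volume-one
simplex with these projected vertices gives the same measure), so the corner simplex is used. For
`d = 0` this is the point mass at `y_0`. -/
def simplexSpline {d : ℕ} (y : Fin (d + 1) → ℝ) : Measure ℝ :=
  (cond (volume : Measure (Fin d → ℝ)) (cornerSimplex d)).map (affineWithValues y)

instance {d : ℕ} (y : Fin (d + 1) → ℝ) : IsFiniteMeasure (simplexSpline y) := by
  unfold simplexSpline; infer_instance

/-- The consecutive simplex splines `μ_1, …, μ_{n-d}`, as signed measures on the line. -/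
def basisSpline (d : ℕ) {n : ℕ} (x : Fin n → ℝ) (i : Fin (n - d)) : SignedMeasure ℝ :=
  (simplexSpline (window x i)).toSignedMeasure

/-- The spline measure `∑ i, α_i μ_i`. -/
def splineMeasure (d : ℕ) {n : ℕ} (x : Fin n → ℝ) (α : Fin (n - d) → ℝ) : SignedMeasure ℝ :=
  ∑ i, α i • basisSpline d x i

/-- The space `L_{d,x}` spanned by the consecutive simplex splines. -/
def splineSpace (d : ℕ) {n : ℕ} (x : Fin n → ℝ) : Submodule ℝ (SignedMeasure ℝ) :=
  Submodule.span ℝ (Set.range (basisSpline d x))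

/-- The positive simplicial spline cone `{∑ i, α_i μ_i : α_i ≥ 0}`. -/
def positiveCone (d : ℕ) {n : ℕ} (x : Fin n → ℝ) : Set (SignedMeasure ℝ) :=
  {ν | ∃ α : Fin (n - d) → ℝ, (∀ i, 0 ≤ α i) ∧ ν = splineMeasure d x α}

/-- The moment `∫ t^j dν(t)` of a signed measure on the line. -/
def lineMoment (ν : SignedMeasure ℝ) (j : ℕ) : ℝ :=
  ν.integral (fun t : ℝ => t ^ j) (ContinuousLinearMap.lsmul ℝ ℝ).flip

end HigherProny

end

open HigherProny

namespace HigherProny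

open Finset

/-! ### Complete homogeneous symmetric polynomials and divided differences -/

/-! For distinct nodes the divided difference of t^k on d+1 nodes is h_{k-d}, and is 0 for k < d
(`powDivDiff_eq`). Hence c_k = ∑ α_i [x_i,…,x_{i+d}] t^k for all k < 2n, and expanding by Lagrange
weights gives a classical Prony sum c_k = ∑ w_l x_l^k (`normalized_splineMoments`), with w linear in
α.

By Vandermonde, H_M u = 0 means w_l p(x_l) = 0 for every l, where p is the polynomial of u. If no
w_l vanishes, the kernel is the line of ∏ (t - x_l). The map α ↦ w is injective by triangularity,
which makes A_{d,n}(x) invertible, so the nodes determine α. After clearing denominators the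
conditions w_l ≠ 0 become nonvanishing of nonzero polynomials, hence Zariski open and dense.

For positivity, the j-th moment of a simplex spline is h_j / binom(j+d, d), so spline moments are
values of the Prony map. If p_M has n simple real roots, the normalized sequences of M and of the
reconstructed measure share their first n terms and an order-n recurrence, so they agree
(`eq_splineMoments_of_roots`). Moments determine the amplitudes, so the cone condition is a sign
condition on α(M). -/

theorem hsymm_option_succ (σ R : Type*) [Fintype σ] [DecidableEq σ] [CommSemiring R] (j : ℕ) :
    MvPolynomial.hsymm (Option σ) R (j + 1) =
      MvPolynomial.X none * MvPolynomial.hsymm (Option σ) R j +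
        MvPolynomial.rename some (MvPolynomial.hsymm σ R (j + 1)) := by
  unfold MvPolynomial.hsymm
  -- A multiset of size j+1 either contains `none`, and one copy is removed, or lives on σ.
  rw [← Equiv.sum_comp symOptionSuccEquiv.symm, Fintype.sum_sum_type, map_sum, mul_sum]
  congr 1
  · refine sum_congr rfl fun s _ => ?_
    simp [symOptionSuccEquiv, SymOptionSuccEquiv.decode, Sym.coe_cons]
  · refine sum_congr rfl fun s _ => ?_
    simp [symOptionSuccEquiv, SymOptionSuccEquiv.decode, map_multiset_prod]

theorem hval_zero {d : ℕ} (y : Fin (d + 1) → ℝ) : hval 0 y = 1 := by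
  simp [hval]

theorem hval_comp_perm {d : ℕ} (j : ℕ) (y : Fin (d + 1) → ℝ) (e : Equiv.Perm (Fin (d + 1))) :
    hval j (y ∘ e) = hval j y := by
  unfold hval
  rw [← MvPolynomial.eval_rename, MvPolynomial.rename_hsymm]

theorem hval_cons_succ {d : ℕ} (j : ℕ) (a : ℝ) (y : Fin (d + 1) → ℝ) :
    hval (j + 1) (Fin.cons a y : Fin (d + 2) → ℝ) =
      a * hval j (Fin.cons a y : Fin (d + 2) → ℝ) + hval (j + 1) y := by
  have key : ∀ k, hval k (Fin.cons a y : Fin (d + 2) → ℝ) =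
      MvPolynomial.eval (fun o : Option (Fin (d + 1)) => o.elim a y)
        (MvPolynomial.hsymm (Option (Fin (d + 1))) ℝ k) := by
    intro k
    rw [← MvPolynomial.rename_hsymm (Fin (d + 2)) ℝ k (finSuccEquiv (d + 1)),
      MvPolynomial.eval_rename, hval]
    congr 2
    funext i
    refine Fin.cases ?_ (fun i => ?_) i <;> simp
  rw [key, key, hsymm_option_succ, map_add, map_mul, MvPolynomial.eval_X,
    MvPolynomial.eval_rename]
  rfl

theorem hval_singleton (j : ℕ) (y : Fin 1 → ℝ) : hval j y = y 0 ^ j := by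
  unfold hval MvPolynomial.hsymm
  rw [Fintype.sum_eq_single (Sym.replicate j (0 : Fin 1)) (fun s hs => (hs ?_).elim)]
  · simp [Sym.coe_replicate]
  · exact Sym.eq_replicate_iff.2 fun b _ => Subsingleton.elim _ _

/-- By symmetry, either a or b can be peeled off h_{j+1}(a, b, r); subtract the two expansions. -/
theorem sub_mul_hval_cons_cons {d : ℕ} (j : ℕ) (a b : ℝ) (r : Fin d → ℝ) :
    (b - a) * hval j (Fin.cons a (Fin.cons b r : Fin (d + 1) → ℝ) : Fin (d + 2) → ℝ) =
      hval (j + 1) (Fin.cons b r : Fin (d + 1) → ℝ) -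
        hval (j + 1) (Fin.cons a r : Fin (d + 1) → ℝ) := by
  have hswap : ∀ k, hval k (Fin.cons b (Fin.cons a r : Fin (d + 1) → ℝ) : Fin (d + 2) → ℝ) =
      hval k (Fin.cons a (Fin.cons b r : Fin (d + 1) → ℝ) : Fin (d + 2) → ℝ) := by
    intro k
    rw [← hval_comp_perm k _ (Equiv.swap 0 1)]
    congr 1
    funext i
    refine Fin.cases ?_ (fun i => Fin.cases ?_ (fun i => ?_) i) i
    · simp only [Function.comp_apply, Equiv.swap_apply_left]
      rfl
    · rw [Function.comp_apply, Fin.succ_zero_eq_one, Equiv.swap_apply_right]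
      rfl
    · have h1 : i.succ.succ ≠ 0 := Fin.succ_ne_zero _
      have h2 : i.succ.succ ≠ (1 : Fin (d + 2)) := by
        rw [← Fin.succ_zero_eq_one, Ne, Fin.succ_inj]
        exact Fin.succ_ne_zero _
      simp [Equiv.swap_apply_of_ne_of_ne h1 h2]
  have h1 := hval_cons_succ j a (Fin.cons b r : Fin (d + 1) → ℝ)
  have h2 := hval_cons_succ j b (Fin.cons a r : Fin (d + 1) → ℝ)
  rw [hswap, hswap] at h2
  linarith

/-- The Lagrange weight `∏_{l ≠ i} (y_i - y_l)⁻¹`. -/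
noncomputable def lagrangeWeight {m : ℕ} (y : Fin m → ℝ) (i : Fin m) : ℝ :=
  ∏ l, if l = i then 1 else (y i - y l)⁻¹

theorem lagrangeWeight_ne_zero {m : ℕ} {y : Fin m → ℝ} (hy : Function.Injective y) (i : Fin m) :
    lagrangeWeight y i ≠ 0 := by
  refine prod_ne_zero_iff.2 fun l _ => ?_
  split_ifs with h
  · exact one_ne_zero
  · exact inv_ne_zero (sub_ne_zero.2 fun h' => h (hy h').symm)

/-- The divided difference of `t ^ k` at the nodes `y`. -/
noncomputable def powDivDiff {m : ℕ} (k : ℕ) (y : Fin m → ℝ) : ℝ :=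
  ∑ i, lagrangeWeight y i * y i ^ k

/-- Compare weights node by node; at r_i this is the partial fraction identity
(b-a)/((r_i-a)(r_i-b)) = 1/(r_i-b) - 1/(r_i-a). -/
theorem sub_mul_powDivDiff_cons_cons {d : ℕ} (k : ℕ) {a b : ℝ} {r : Fin d → ℝ} (hab : a ≠ b)
    (ha : ∀ i, r i ≠ a) (hb : ∀ i, r i ≠ b) :
    (b - a) * powDivDiff k (Fin.cons a (Fin.cons b r : Fin (d + 1) → ℝ) : Fin (d + 2) → ℝ) =
      powDivDiff k (Fin.cons b r : Fin (d + 1) → ℝ) -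
        powDivDiff k (Fin.cons a r : Fin (d + 1) → ℝ) := by
  have hba : b - a ≠ 0 := sub_ne_zero.2 hab.symm
  have hab' : a - b ≠ 0 := sub_ne_zero.2 hab
  have h01 : ∀ i : Fin d, ¬ (1 : Fin (d + 2)) = i.succ.succ := fun i h =>
    (Fin.succ_ne_zero i) (Fin.succ_injective _ (h.symm.trans Fin.succ_zero_eq_one.symm))
  simp only [powDivDiff, lagrangeWeight, Fin.sum_univ_succ, Fin.prod_univ_succ, Fin.cons_zero,
    Fin.cons_succ, Fin.succ_inj, Fin.succ_ne_zero, (Fin.succ_ne_zero _).symm, if_true, if_false,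
    one_mul]
  have hs : ∀ i : Fin d,
      (b - a) * ((r i - a)⁻¹ * ((r i - b)⁻¹ * ∏ l, if l = i then 1 else (r i - r l)⁻¹) * r i ^ k)
      = ((r i - b)⁻¹ * ∏ l, if l = i then 1 else (r i - r l)⁻¹) * r i ^ k
        - ((r i - a)⁻¹ * ∏ l, if l = i then 1 else (r i - r l)⁻¹) * r i ^ k := by
    intro i
    have h1 : r i - a ≠ 0 := sub_ne_zero.2 (ha i)
    have h2 : r i - b ≠ 0 := sub_ne_zero.2 (hb i)
    field_simp
    ring
  rw [mul_add, mul_add, mul_sum, sum_congr rfl fun i _ => hs i, sum_sub_distrib]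
  have e1 : (b - a) * ((a - b)⁻¹ * (∏ i, (a - r i)⁻¹) * a ^ k) = -((∏ i, (a - r i)⁻¹) * a ^ k) := by
    field_simp
    ring
  have e2 : (b - a) * ((b - a)⁻¹ * (∏ i, (b - r i)⁻¹) * b ^ k) = (∏ i, (b - r i)⁻¹) * b ^ k := by
    field_simp
  rw [e1, e2]
  ring

theorem injective_cons_cons {d : ℕ} {a b : ℝ} {r : Fin d → ℝ}
    (h : Function.Injective (Fin.cons a (Fin.cons b r : Fin (d + 1) → ℝ) : Fin (d + 2) → ℝ)) :
    a ≠ b ∧ (∀ i, r i ≠ a) ∧ (∀ i, r i ≠ b) ∧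
      Function.Injective (Fin.cons b r : Fin (d + 1) → ℝ) ∧
      Function.Injective (Fin.cons a r : Fin (d + 1) → ℝ) := by
  obtain ⟨h1, h2⟩ := Fin.cons_injective_iff.1 h
  obtain ⟨h3, h4⟩ := Fin.cons_injective_iff.1 h2
  have ha : ∀ i, r i ≠ a := fun i hi => h1 ⟨i.succ, by simpa using hi⟩
  refine ⟨fun hab => h1 ⟨0, by simpa using hab.symm⟩, ha, fun i hi => h3 ⟨i, hi⟩, h2,
    Fin.cons_injective_iff.2 ⟨?_, h4⟩⟩
  rintro ⟨i, hi⟩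
  exact ha i hi

/-- Induction on the number of nodes along the recursion of divided differences. -/
theorem nodes_induction {p : ∀ d : ℕ, (Fin (d + 1) → ℝ) → Prop}
    (h0 : ∀ y : Fin 1 → ℝ, p 0 y)
    (hs : ∀ (d : ℕ) (a b : ℝ) (r : Fin d → ℝ), a ≠ b → (∀ i, r i ≠ a) → (∀ i, r i ≠ b) →
      p d (Fin.cons b r) → p d (Fin.cons a r) → p (d + 1) (Fin.cons a (Fin.cons b r))) :
    ∀ (d : ℕ) (y : Fin (d + 1) → ℝ), Function.Injective y → p d y := by
  intro d
  induction d with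
  | zero => exact fun y _ => h0 y
  | succ d ih =>
    intro y hy
    have e : y = Fin.cons (y 0) (Fin.cons (y 1) (Fin.tail (Fin.tail y)) : Fin (d + 1) → ℝ) := by
      rw [show y 1 = Fin.tail y 0 from rfl, Fin.cons_self_tail, Fin.cons_self_tail]
    rw [e] at hy ⊢
    obtain ⟨h1, h2, h3, h4, h5⟩ := injective_cons_cons hy
    exact hs d _ _ _ h1 h2 h3 (ih _ h4) (ih _ h5)

/-- Both sides obey the same two-node recursion and agree on a single node. -/
theorem powDivDiff_eq {d : ℕ} {y : Fin (d + 1) → ℝ} (hy : Function.Injective y) :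
    ∀ k, powDivDiff k y = if k < d then 0 else hval (k - d) y := by
  refine nodes_induction (p := fun d y => ∀ k, powDivDiff k y = if k < d then 0 else hval (k - d) y)
    ?_ ?_ d y hy
  · intro y k
    simp [powDivDiff, lagrangeWeight, hval_singleton, Fin.default_eq_zero]
  · intro d a b r hab ha hb hB hA k
    have hba : b - a ≠ 0 := sub_ne_zero.2 hab.symm
    apply mul_left_cancel₀ hba
    rw [sub_mul_powDivDiff_cons_cons k hab ha hb, hB, hA]
    rcases lt_trichotomy k d with h | rfl | h
    · simp [h, h.trans (Nat.lt_succ_self d)]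
    -- At k = d both shorter differences equal h_0 = 1 and cancel, which extends the vanishing range
    -- by one.
    · simp [hval_zero]
    · obtain ⟨j, rfl⟩ := Nat.exists_eq_add_of_lt h
      rw [if_neg (by omega), if_neg (by omega), if_neg (by omega),
        show d + j + 1 - d = j + 1 by omega, show d + j + 1 - (d + 1) = j by omega,
        sub_mul_hval_cons_cons]

theorem powDivDiff_add {d : ℕ} {y : Fin (d + 1) → ℝ} (hy : Function.Injective y) (j : ℕ) :
    powDivDiff (j + d) y = hval j y := by
  rw [powDivDiff_eq hy, if_neg (by omega), Nat.add_sub_cancel]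

theorem powDivDiff_eq_zero {d : ℕ} {y : Fin (d + 1) → ℝ} (hy : Function.Injective y) {k : ℕ}
    (hk : k < d) : powDivDiff k y = 0 := by
  rw [powDivDiff_eq hy, if_pos hk]

end HigherProny

namespace HigherProny

open Finset

/-! ### Moments of simplex splines -/

theorem isCompact_cornerSimplex (d : ℕ) : IsCompact (cornerSimplex d) := by
  have hcl : IsClosed (cornerSimplex d) := by
    have e : cornerSimplex d = (⋂ k, {u : Fin d → ℝ | 0 ≤ u k}) ∩ {u | ∑ k, u k ≤ 1} := by
      ext u
      simp [cornerSimplex]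
    rw [e]
    exact (isClosed_iInter fun k => isClosed_le continuous_const (continuous_apply k)).inter
      (isClosed_le (by fun_prop) continuous_const)
  refine (isCompact_Icc (a := (0 : Fin d → ℝ)) (b := 1)).of_isClosed_subset hcl ?_
  rintro u ⟨h0, h1⟩
  exact ⟨h0, fun k => (single_le_sum (fun i _ => h0 i) (mem_univ k)).trans h1⟩

theorem measurableSet_cornerSimplex (d : ℕ) : MeasurableSet (cornerSimplex d) :=
  (isCompact_cornerSimplex d).measurableSet

theorem cons_mem_cornerSimplex {d : ℕ} (t : ℝ) (v : Fin d → ℝ) :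
    (Fin.cons t v : Fin (d + 1) → ℝ) ∈ cornerSimplex (d + 1) ↔
      v ∈ cornerSimplex d ∧ t ∈ Set.Icc 0 (1 - ∑ k, v k) := by
  simp only [cornerSimplex, Set.mem_ofPred_eq, Fin.forall_fin_succ, Fin.sum_univ_succ,
    Fin.cons_zero, Fin.cons_succ, Set.mem_Icc]
  constructor
  · rintro ⟨⟨h0, h1⟩, h2⟩
    exact ⟨⟨h1, by linarith⟩, h0, by linarith⟩
  · rintro ⟨⟨h1, h2⟩, h0, h3⟩
    exact ⟨⟨h0, h1⟩, by linarith⟩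

theorem setIntegral_cornerSimplex_succ {d : ℕ} {f : (Fin (d + 1) → ℝ) → ℝ} (hf : Continuous f) :
    ∫ u in cornerSimplex (d + 1), f u =
      ∫ v in cornerSimplex d, ∫ t in (0 : ℝ)..(1 - ∑ k, v k), f (Fin.cons t v) := by
  have hmp := (volume_preserving_piFinSuccAbove (fun _ : Fin (d + 1) => ℝ) 0).symm
  have he : ∀ p : ℝ × (Fin d → ℝ),
      (MeasurableEquiv.piFinSuccAbove (fun _ : Fin (d + 1) => ℝ) 0).symm p = Fin.cons p.1 p.2 := by
    intro p
    exact Fin.insertNth_zero' _ _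
  have hint : Integrable ((cornerSimplex (d + 1)).indicator f) :=
    (hf.continuousOn.integrableOn_compact (isCompact_cornerSimplex _)).integrable_indicator
      (measurableSet_cornerSimplex _)
  rw [← integral_indicator (measurableSet_cornerSimplex _),
    ← hmp.integral_comp (MeasurableEquiv.measurableEmbedding _)]
  have hint' := (hmp.integrable_comp_emb (MeasurableEquiv.measurableEmbedding _)).2 hint
  simp only [he]
  rw [Measure.volume_eq_prod, integral_prod_symm]
  swap
  · rw [← Measure.volume_eq_prod]
    refine hint'.congr (Filter.Eventually.of_forall fun p => ?_)
    simp only [Function.comp_apply, he]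
  rw [← integral_indicator (measurableSet_cornerSimplex _)]
  congr 1
  funext v
  by_cases hv : v ∈ cornerSimplex d
  · rw [Set.indicator_of_mem hv, intervalIntegral.integral_of_le (sub_nonneg.2 hv.2),
      ← integral_Icc_eq_integral_Ioc, ← integral_indicator measurableSet_Icc]
    congr 1
    funext t
    by_cases ht : t ∈ Set.Icc 0 (1 - ∑ k, v k)
    · rw [Set.indicator_of_mem ht, Set.indicator_of_mem ((cons_mem_cornerSimplex t v).2 ⟨hv, ht⟩)]
    · rw [Set.indicator_of_notMem ht,
        Set.indicator_of_notMem fun h => ht ((cons_mem_cornerSimplex t v).1 h).2]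
  · rw [Set.indicator_of_notMem hv]
    refine integral_eq_zero_of_ae (Filter.Eventually.of_forall fun t => ?_)
    exact Set.indicator_of_notMem (fun h => hv ((cons_mem_cornerSimplex t v).1 h).1) _

theorem continuous_affineWithValues {d : ℕ} (y : Fin (d + 1) → ℝ) :
    Continuous (affineWithValues y) := by
  unfold affineWithValues
  fun_prop

/-- The first coordinate slides the knot a towards b, so integrating a power in t produces a
difference of two lower-dimensional integrands. -/
theorem affineWithValues_cons_cons {d : ℕ} (a b : ℝ) (r : Fin d → ℝ) (t : ℝ) (v : Fin d → ℝ) :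
    affineWithValues (Fin.cons a (Fin.cons b r : Fin (d + 1) → ℝ) : Fin (d + 2) → ℝ)
        (Fin.cons t v : Fin (d + 1) → ℝ) =
      affineWithValues (Fin.cons a r : Fin (d + 1) → ℝ) v + (b - a) * t := by
  simp only [affineWithValues, Fin.sum_univ_succ, Fin.cons_zero, Fin.cons_succ]
  ring

theorem integrableOn_affineWithValues_pow {d : ℕ} (y : Fin (d + 1) → ℝ) (j : ℕ) :
    IntegrableOn (fun u => affineWithValues y u ^ j) (cornerSimplex d) :=
  ((continuous_affineWithValues y).pow j).continuousOn.integrableOn_compact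
    (isCompact_cornerSimplex d)

/-- The moments of Lebesgue measure on a simplex under an affine projection. -/
theorem setIntegral_affineWithValues_pow {d : ℕ} {y : Fin (d + 1) → ℝ}
    (hy : Function.Injective y) :
    ∀ j : ℕ, ∫ u in cornerSimplex d, affineWithValues y u ^ j =
      (j.factorial : ℝ) / (j + d).factorial * hval j y := by
  refine nodes_induction (p := fun d y => ∀ j : ℕ,
    ∫ u in cornerSimplex d, affineWithValues y u ^ j =
      (j.factorial : ℝ) / (j + d).factorial * hval j y) ?_ ?_ d y hy
  · intro y j
    have hT : cornerSimplex 0 = Set.univ := by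
      ext u
      simp [cornerSimplex]
    have hj : (j.factorial : ℝ) ≠ 0 := by exact_mod_cast j.factorial_ne_zero
    rw [hT, setIntegral_univ, volume_pi, Measure.pi_of_empty _ (0 : Fin 0 → ℝ), integral_dirac]
    simp [affineWithValues, hval_singleton, div_self hj]
  · intro d a b r hab ha hb hB hA j
    have hba : b - a ≠ 0 := sub_ne_zero.2 hab.symm
    rw [setIntegral_cornerSimplex_succ
      (f := fun u => affineWithValues
        (Fin.cons a (Fin.cons b r : Fin (d + 1) → ℝ) : Fin (d + 2) → ℝ) u ^ j)
      ((continuous_affineWithValues _).pow j)]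
    -- At the upper end t = 1 - ∑ v_k the weight of a has passed entirely to b. Integrating over v
    -- then reproduces the recursion for h_j.
    have hin : ∀ v : Fin d → ℝ,
        (∫ t in (0 : ℝ)..(1 - ∑ k, v k),
          affineWithValues (Fin.cons a (Fin.cons b r : Fin (d + 1) → ℝ) : Fin (d + 2) → ℝ)
            (Fin.cons t v : Fin (d + 1) → ℝ) ^ j) =
        ((b - a)⁻¹ / (j + 1)) * (affineWithValues (Fin.cons b r : Fin (d + 1) → ℝ) v ^ (j + 1) -
            affineWithValues (Fin.cons a r : Fin (d + 1) → ℝ) v ^ (j + 1)) := by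
      intro v
      simp only [affineWithValues_cons_cons]
      rw [intervalIntegral.integral_comp_add_mul (fun s => s ^ j) hba, integral_pow]
      have e : affineWithValues (Fin.cons a r : Fin (d + 1) → ℝ) v + (b - a) * (1 - ∑ k, v k) =
          affineWithValues (Fin.cons b r : Fin (d + 1) → ℝ) v := by
        simp only [affineWithValues, Fin.cons_zero, Fin.cons_succ]
        ring
      rw [e, mul_zero, add_zero, smul_eq_mul]
      ring
    simp only [hin]
    rw [integral_const_mul, integral_sub (integrableOn_affineWithValues_pow _ _)
      (integrableOn_affineWithValues_pow _ _), hB, hA, ← mul_sub, ← sub_mul_hval_cons_cons,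
      Nat.factorial_succ, show j + 1 + d = j + (d + 1) by omega]
    have : ((j + (d + 1)).factorial : ℝ) ≠ 0 := by exact_mod_cast Nat.factorial_ne_zero _
    push_cast
    field_simp

theorem volume_real_cornerSimplex {d : ℕ} :
    (volume : Measure (Fin d → ℝ)).real (cornerSimplex d) = ((d.factorial : ℝ))⁻¹ := by
  -- The volume is the zeroth moment for any distinct knots; 0, …, d is an arbitrary choice.
  have hy : Function.Injective fun k : Fin (d + 1) => (k : ℝ) := fun a b h => by
    simpa [Fin.ext_iff] using h
  have := setIntegral_affineWithValues_pow hy 0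
  simpa [hval_zero] using this

theorem integrable_pow_simplexSpline {d : ℕ} (y : Fin (d + 1) → ℝ) (j : ℕ) :
    Integrable (fun t : ℝ => t ^ j) (simplexSpline y) := by
  rw [simplexSpline, integrable_map_measure (by fun_prop)
    (continuous_affineWithValues y).aemeasurable, ProbabilityTheory.cond]
  refine Integrable.smul_measure (integrableOn_affineWithValues_pow y j) (ENNReal.inv_ne_top.2 ?_)
  intro h
  have := volume_real_cornerSimplex (d := d)
  rw [Measure.real, h, ENNReal.toReal_zero] at this
  exact inv_ne_zero (Nat.cast_ne_zero.2 d.factorial_ne_zero) this.symm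

theorem integral_pow_simplexSpline {d : ℕ} {y : Fin (d + 1) → ℝ} (hy : Function.Injective y)
    (j : ℕ) :
    ∫ t, t ^ j ∂simplexSpline y = hval j y / ((j + d).choose d : ℝ) := by
  rw [simplexSpline, integral_map (continuous_affineWithValues y).aemeasurable (by fun_prop),
    ProbabilityTheory.cond, integral_smul_measure, setIntegral_affineWithValues_pow hy,
    ENNReal.toReal_inv, ← Measure.real, volume_real_cornerSimplex, inv_inv, smul_eq_mul,
    Nat.add_comm j d, Nat.cast_add_choose]
  have h1 : (j.factorial : ℝ) ≠ 0 := by exact_mod_cast Nat.factorial_ne_zero _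
  have h2 : (d.factorial : ℝ) ≠ 0 := by exact_mod_cast Nat.factorial_ne_zero _
  have h3 : ((d + j).factorial : ℝ) ≠ 0 := by exact_mod_cast Nat.factorial_ne_zero _
  field_simp

theorem window_injective {d n : ℕ} {x : Fin n → ℝ} (hx : Function.Injective x) (i : Fin (n - d)) :
    Function.Injective (window x i) := fun a b h => by
  have := hx h
  simpa [Fin.ext_iff] using this

theorem lineMoment_splineMeasure {d n : ℕ} {x : Fin n → ℝ} (hx : Function.Injective x)
    (α : Fin (n - d) → ℝ) (j : ℕ) :
    lineMoment (splineMeasure d x α) j =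
      (∑ i, α i * hval j (window x i)) / ((j + d).choose d : ℝ) := by
  have hint : ∀ i, (basisSpline d x i).Integrable (fun t : ℝ => t ^ j) := fun i => by
    rw [VectorMeasure.Integrable, basisSpline, Measure.variation_toSignedMeasure]
    exact integrable_pow_simplexSpline _ j
  rw [lineMoment, splineMeasure, VectorMeasure.integral_finsetSum_vectorMeasure
    fun i _ => (hint i).smul_vectorMeasure _, sum_div]
  refine sum_congr rfl fun i _ => ?_
  rw [VectorMeasure.integral_smul_vectorMeasure, basisSpline,
    VectorMeasure.integral_toSignedMeasure, integral_pow_simplexSpline (window_injective hx i),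
    smul_eq_mul, mul_div_assoc]

end HigherProny

namespace HigherProny

open Finset

/-! ### The Prony system as an exponential sum over the nodes -/

/-- The index `i + s` of the `s`-th node of the `i`-th window. -/
def windowIndex {d n : ℕ} (i : Fin (n - d)) (s : Fin (d + 1)) : Fin n := ⟨i.1 + s.1, by omega⟩

theorem windowIndex_injective {d n : ℕ} (i : Fin (n - d)) :
    Function.Injective (windowIndex (d := d) (n := n) i) := fun a b h => by
  simpa [windowIndex, Fin.ext_iff] using h

/-- The coefficient of the point evaluation at `x_l` in
`∑ i, α_i [x_i, …, x_{i+d}]`, where the brackets denote divided differences. -/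
noncomputable def nodeWeight {d n : ℕ} (x : Fin n → ℝ) (α : Fin (n - d) → ℝ) (l : Fin n) : ℝ :=
  ∑ i, α i * ∑ s, if windowIndex i s = l then lagrangeWeight (window x i) s else 0

theorem sum_mul_powDivDiff_window {d n : ℕ} (x : Fin n → ℝ) (α : Fin (n - d) → ℝ) (k : ℕ) :
    ∑ i, α i * powDivDiff k (window x i) = ∑ l, nodeWeight x α l * x l ^ k := by
  simp only [nodeWeight, sum_mul, mul_assoc]
  rw [sum_comm]
  refine sum_congr rfl fun i _ => ?_
  rw [← mul_sum, powDivDiff]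
  congr 1
  rw [sum_comm]
  refine sum_congr rfl fun s _ => ?_
  simp only [ite_mul, zero_mul, sum_ite_eq, mem_univ, if_true]
  rfl

/-- Triangularity: node m lies in window m and otherwise only in earlier windows. Once the earlier
amplitudes vanish, w_m is α_m times a nonzero Lagrange weight. -/
theorem eq_zero_of_nodeWeight_eq_zero {d n : ℕ} {x : Fin n → ℝ} (hx : Function.Injective x)
    {α : Fin (n - d) → ℝ} (h : nodeWeight x α = 0) : α = 0 := by
  have key : ∀ m (hm : m < n - d), α ⟨m, hm⟩ = 0 := by
    intro m
    induction m using Nat.strong_induction_on with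
    | _ m ih =>
      intro hm
      have hl := congrFun h (windowIndex ⟨m, hm⟩ 0)
      rw [nodeWeight, Fintype.sum_eq_single ⟨m, hm⟩, Fintype.sum_eq_single 0, if_pos rfl] at hl
      · exact (mul_eq_zero.1 hl).resolve_right
          (lagrangeWeight_ne_zero (window_injective hx _) _)
      · intro s hs
        exact if_neg fun h' => hs (windowIndex_injective _ h')
      · intro i hi
        rcases lt_or_gt_of_ne (fun h' => hi (Fin.ext h') : i.1 ≠ m) with h1 | h1
        · rw [ih i h1 i.2, zero_mul]
        · rw [sum_eq_zero, mul_zero]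
          intro s _
          refine if_neg fun h' => ?_
          have := congrArg Fin.val h'
          simp only [windowIndex, Fin.val_zero] at this
          omega
  exact funext fun i => key i i.2

theorem isUnit_det_ampMatrix {d n : ℕ} {x : Fin n → ℝ} (hx : Function.Injective x) :
    IsUnit (ampMatrix d x).det := by
  rw [isUnit_iff_ne_zero]
  intro h
  obtain ⟨α, hα, h0⟩ := Matrix.exists_mulVec_eq_zero_iff.2 h
  refine hα (eq_zero_of_nodeWeight_eq_zero hx
    (Matrix.eq_zero_of_forall_pow_sum_mul_pow_eq_zero hx fun k => ?_))
  rw [← sum_mul_powDivDiff_window]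
  -- Of the n Vandermonde equations on w, the first d hold automatically and the other n-d are the
  -- rows of A α = 0.
  by_cases hk : k.1 < d
  · simp only [powDivDiff_eq_zero (window_injective hx _) hk, mul_zero, sum_const_zero]
  · have := congrFun h0 ⟨k.1 - d, by omega⟩
    simp only [Matrix.mulVec, dotProduct, ampMatrix, Matrix.of_apply, Pi.zero_apply] at this
    rw [← this]
    refine sum_congr rfl fun i _ => ?_
    rw [← powDivDiff_add (window_injective hx i), Nat.sub_add_cancel (not_lt.1 hk), mul_comm]

/-- The moments `m_0, …, m_{2n-d-1}` of `∑ i, α_i μ_i`. -/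
noncomputable def splineMoments {d n : ℕ} (x : Fin n → ℝ) (α : Fin (n - d) → ℝ) :
    Fin (2 * n - d) → ℝ := fun j =>
  (∑ i, α i * hval j.1 (window x i)) / ((j.1 + d).choose d : ℝ)

theorem pronyMap_eq_splineMoments {d n : ℕ} (θ : Params d n) :
    pronyMap d n θ = splineMoments (nodes θ) (amps θ) := rfl

theorem choose_add_ne_zero (j d : ℕ) : ((j + d).choose d : ℝ) ≠ 0 :=
  Nat.cast_ne_zero.2 (Nat.choose_pos (Nat.le_add_left d j)).ne'

theorem rhs_splineMoments {d n : ℕ} (x : Fin n → ℝ) (α : Fin (n - d) → ℝ) :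
    rhs (splineMoments x α) = (ampMatrix d x).mulVec α := by
  funext r
  simp only [rhs, splineMoments, Matrix.mulVec, dotProduct, ampMatrix, Matrix.of_apply]
  rw [mul_div_cancel₀ _ (choose_add_ne_zero _ _)]
  exact sum_congr rfl fun i _ => mul_comm _ _

theorem mulVec_ampMatrix_eq_rhs_iff {d n : ℕ} {x : Fin n → ℝ} (hx : Function.Injective x)
    (M : Fin (2 * n - d) → ℝ) (α : Fin (n - d) → ℝ) :
    (ampMatrix d x).mulVec α = rhs M ↔ α = (ampMatrix d x)⁻¹.mulVec (rhs M) := by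
  have hu := isUnit_det_ampMatrix (d := d) hx
  constructor
  · intro h
    rw [← h, Matrix.mulVec_mulVec, Matrix.nonsing_inv_mul _ hu, Matrix.one_mulVec]
  · rintro rfl
    rw [Matrix.mulVec_mulVec, Matrix.mul_nonsing_inv _ hu, Matrix.one_mulVec]

theorem normalized_splineMoments {d n : ℕ} {x : Fin n → ℝ} (hx : Function.Injective x)
    (α : Fin (n - d) → ℝ) (k : Fin (2 * n)) :
    normalized (splineMoments x α) k = ∑ l, nodeWeight x α l * x l ^ k.1 := by
  rw [← sum_mul_powDivDiff_window, normalized]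
  split_ifs with hk
  · simp only [powDivDiff_eq_zero (window_injective hx _) hk, mul_zero, sum_const_zero]
  · have hkd := Nat.sub_add_cancel (not_lt.1 hk)
    have hc := choose_add_ne_zero (k.1 - d) d
    simp only [splineMoments]
    rw [hkd] at hc ⊢
    rw [mul_div_cancel₀ _ hc]
    refine sum_congr rfl fun i _ => ?_
    rw [← powDivDiff_add (window_injective hx i), hkd]

/-! ### The kernel polynomial -/

theorem coeff_kernelPoly {n : ℕ} (u : Fin (n + 1) → ℝ) (j : Fin (n + 1)) :
    (kernelPoly u).coeff j = u j := by
  simp only [kernelPoly, Polynomial.finsetSum_coeff, Polynomial.coeff_C_mul_X_pow]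
  rw [Fintype.sum_eq_single j, if_pos rfl]
  exact fun i hi => if_neg fun h => hi (Fin.ext h.symm)

theorem natDegree_kernelPoly_le {n : ℕ} (u : Fin (n + 1) → ℝ) : (kernelPoly u).natDegree ≤ n :=
  Polynomial.natDegree_sum_le_of_forall_le _ _ fun j _ =>
    (Polynomial.natDegree_C_mul_X_pow_le _ _).trans (Nat.lt_succ_iff.1 j.2)

theorem kernelPoly_ne_zero {n : ℕ} {u : Fin (n + 1) → ℝ} (hu : u ≠ 0) : kernelPoly u ≠ 0 := by
  intro h
  refine hu (funext fun j => ?_)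
  rw [← coeff_kernelPoly u j, h, Polynomial.coeff_zero, Pi.zero_apply]

theorem kernelPoly_coeff {n : ℕ} {p : Polynomial ℝ} (hp : p.natDegree ≤ n) :
    kernelPoly (fun j : Fin (n + 1) => p.coeff j) = p := by
  rw [kernelPoly, Fin.sum_univ_eq_sum_range (fun j => Polynomial.C (p.coeff j) * Polynomial.X ^ j)]
  exact (p.as_sum_range_C_mul_X_pow' (Nat.lt_succ_iff.2 hp)).symm

/-- A nonzero polynomial of degree at most n has no room for roots beyond n distinct ones. -/
theorem roots_kernelPoly {n : ℕ} {u : Fin (n + 1) → ℝ} (hu : u ≠ 0) {x : Fin n → ℝ}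
    (hx : Function.Injective x) (h : ∀ l, (kernelPoly u).eval (x l) = 0) :
    (kernelPoly u).natDegree = n ∧ (kernelPoly u).roots = univ.val.map x := by
  have hp := kernelPoly_ne_zero hu
  have hle : univ.val.map x ≤ (kernelPoly u).roots := by
    rw [Multiset.le_iff_subset (Multiset.Nodup.map hx univ.nodup)]
    intro t ht
    obtain ⟨l, -, rfl⟩ := Multiset.mem_map.1 ht
    exact (Polynomial.mem_roots hp).2 (h l)
  have hcard : (univ.val.map x).card = n := by simp
  have h1 := Multiset.card_le_card hle
  have h2 := (kernelPoly u).card_roots'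
  have h3 := natDegree_kernelPoly_le u
  exact ⟨by omega, (Multiset.eq_of_le_of_card_le hle (by omega)).symm⟩

theorem eval_kernelPoly {n : ℕ} (u : Fin (n + 1) → ℝ) (t : ℝ) :
    (kernelPoly u).eval t = ∑ j, u j * t ^ j.1 := by
  simp [kernelPoly, Polynomial.eval_finsetSum]

theorem mem_hankelKer_iff {d n : ℕ} (M : Fin (2 * n - d) → ℝ) (u : Fin (n + 1) → ℝ) :
    u ∈ hankelKer M ↔
      ∀ i : Fin n, ∑ j : Fin (n + 1), normalized M ⟨i.1 + j.1, by omega⟩ * u j = 0 := by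
  rw [hankelKer, LinearMap.mem_ker, funext_iff]
  rfl

/-- The Hankel matrix factors as Vᵀ diag(w) V', with V, V' Vandermonde in x and V square and
invertible; V' u lists the values of the kernel polynomial at the nodes. -/
theorem mem_hankelKer_splineMoments_iff {d n : ℕ} {x : Fin n → ℝ} (hx : Function.Injective x)
    (α : Fin (n - d) → ℝ) (u : Fin (n + 1) → ℝ) :
    u ∈ hankelKer (splineMoments x α) ↔
      ∀ l, nodeWeight x α l * (kernelPoly u).eval (x l) = 0 := by
  have e : ∀ i : Fin n,
      ∑ j : Fin (n + 1), normalized (splineMoments x α) ⟨i.1 + j.1, by omega⟩ * u j =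
        ∑ l, nodeWeight x α l * (kernelPoly u).eval (x l) * x l ^ i.1 := by
    intro i
    simp only [normalized_splineMoments hx, eval_kernelPoly, sum_mul, mul_sum]
    rw [sum_comm]
    refine sum_congr rfl fun l _ => sum_congr rfl fun j _ => ?_
    ring
  rw [mem_hankelKer_iff]
  simp only [e]
  constructor
  · intro h
    exact congrFun (Matrix.eq_zero_of_forall_pow_sum_mul_pow_eq_zero hx h)
  · intro h i
    simp only [h, zero_mul, sum_const_zero]

theorem finrank_hankelKer_splineMoments {d n : ℕ} {x : Fin n → ℝ} (hx : Function.Injective x)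
    {α : Fin (n - d) → ℝ} (h : ∀ l, nodeWeight x α l ≠ 0) :
    Module.finrank ℝ (hankelKer (splineMoments x α)) = 1 := by
  have hmem : ∀ u, u ∈ hankelKer (splineMoments x α) ↔ ∀ l, (kernelPoly u).eval (x l) = 0 := by
    intro u
    rw [mem_hankelKer_splineMoments_iff hx]
    exact forall_congr' fun l => by simp [h l]
  set p : Polynomial ℝ := ∏ l, (Polynomial.X - Polynomial.C (x l)) with hp
  have hpdeg : p.natDegree = n := by
    rw [hp, Polynomial.natDegree_finsetProd_X_sub_C_eq_card]
    simp
  have hpm : p.Monic := Polynomial.monic_prod_X_sub_C _ _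
  have hpn : p.coeff n = 1 := by
    conv_lhs => rw [← hpdeg]
    exact hpm
  set u₀ : Fin (n + 1) → ℝ := fun j => p.coeff j with hu₀
  have hlast : u₀ (Fin.last n) = 1 := by simpa [hu₀] using hpn
  have hu₀mem : u₀ ∈ hankelKer (splineMoments x α) := by
    rw [hmem]
    intro l
    rw [hu₀, kernelPoly_coeff hpdeg.le, hp, Polynomial.eval_prod]
    exact prod_eq_zero (mem_univ l) (by simp)
  refine finrank_eq_one_iff'.2 ⟨⟨u₀, hu₀mem⟩, ?_, ?_⟩
  · intro h0
    exact one_ne_zero (hlast.symm.trans (congrFun (congrArg Subtype.val h0) (Fin.last n)))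
  · rintro ⟨w, hw⟩
    refine ⟨w (Fin.last n), Subtype.ext ?_⟩
    -- The difference has zero t^n coefficient, yet if nonzero it would have n distinct roots and so
    -- degree n.
    have hsub := Submodule.sub_mem _ (Submodule.smul_mem _ (w (Fin.last n)) hu₀mem) hw
    by_contra hne
    have hv : w (Fin.last n) • u₀ - w ≠ 0 := sub_ne_zero.2 hne
    have hdeg := (roots_kernelPoly hv hx ((hmem _).1 hsub)).1
    have hc := Polynomial.leadingCoeff_ne_zero.2 (kernelPoly_ne_zero hv)
    rw [Polynomial.leadingCoeff, hdeg] at hc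
    refine hc ((coeff_kernelPoly _ (Fin.last n)).trans ?_)
    simp [hlast]

/-- Real data whose kernel polynomial has simple real roots `x` are the moments of the
reconstructed spline measure. -/
theorem eq_splineMoments_of_roots {d n : ℕ} {M : Fin (2 * n - d) → ℝ}
    {u : Fin (n + 1) → ℝ} {x : Fin n → ℝ} (hu : u ∈ hankelKer M) (hu0 : u ≠ 0)
    (hx : Function.Injective x) (hroots : (kernelPoly u).roots = univ.val.map x) :
    splineMoments x ((ampMatrix d x)⁻¹.mulVec (rhs M)) = M := by
  set α := (ampMatrix d x)⁻¹.mulVec (rhs M)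
  have heval : ∀ l, (kernelPoly u).eval (x l) = 0 := by
    intro l
    have : x l ∈ (kernelPoly u).roots := by
      rw [hroots]
      exact Multiset.mem_map_of_mem x (mem_univ_val l)
    exact (Polynomial.mem_roots'.1 this).2
  have hlast : u (Fin.last n) ≠ 0 := by
    have hc := Polynomial.leadingCoeff_ne_zero.2 (kernelPoly_ne_zero hu0)
    rw [Polynomial.leadingCoeff, (roots_kernelPoly hu0 hx heval).1] at hc
    exact fun h => hc ((coeff_kernelPoly u (Fin.last n)).trans h)
  -- Thus u gives one order-n recurrence for both sequences; `hlast` lets it be solved for its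
  -- newest term.
  have hu' : u ∈ hankelKer (splineMoments x α) := by
    rw [mem_hankelKer_splineMoments_iff hx]
    exact fun l => by rw [heval, mul_zero]
  have hrhs : rhs (splineMoments x α) = rhs M := by
    rw [rhs_splineMoments, mulVec_ampMatrix_eq_rhs_iff hx]
  rw [mem_hankelKer_iff] at hu hu'
  have key : ∀ k (hk : k < 2 * n),
      normalized (splineMoments x α) ⟨k, hk⟩ = normalized M ⟨k, hk⟩ := by
    intro k
    induction k using Nat.strong_induction_on with
    | _ k ih =>
      intro hk
      -- The first n terms are d zeros and the n-d entries of `rhs`; each later one follows from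
      -- Hankel row k-n.
      rcases lt_or_ge k n with hkn | hkn
      · simp only [normalized]
        split_ifs with hkd
        · rfl
        · have := congrFun hrhs ⟨k - d, by omega⟩
          simpa only [rhs, Nat.sub_add_cancel (not_lt.1 hkd)] using this
      · have h1 := hu ⟨k - n, by omega⟩
        have h2 := hu' ⟨k - n, by omega⟩
        rw [Fin.sum_univ_castSucc] at h1 h2
        have e : ∀ j : Fin n, normalized (splineMoments x α) ⟨k - n + j.castSucc.1, by
            have := j.2; simp only [Fin.val_castSucc]; omega⟩ =
            normalized M ⟨k - n + j.castSucc.1, by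
              have := j.2; simp only [Fin.val_castSucc]; omega⟩ := fun j =>
          ih _ (by have := j.2; simp only [Fin.val_castSucc]; omega) _
        simp only [e] at h2
        have h3 := add_left_cancel (h2.trans h1.symm)
        have h4 := mul_right_cancel₀ hlast h3
        simpa only [Fin.val_last, Nat.sub_add_cancel hkn] using h4
  funext j
  have h := key (j.1 + d) (by omega)
  simp only [normalized] at h
  rw [dif_neg (by omega), dif_neg (by omega)] at h
  simpa only [Nat.add_sub_cancel] using mul_left_cancel₀ (choose_add_ne_zero j.1 d) h

end HigherProny

namespace HigherProny

open Finset

/-! ### Genericity -/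

theorem isOpen_zariski_aeval_ne_zero {σ : Type*} (q : MvPolynomial σ ℝ) :
    IsOpen[zariskiTopology σ] {θ | MvPolynomial.aeval θ q ≠ 0} := by
  refine ⟨Ideal.span {q}, ?_⟩
  rw [MvPolynomial.zeroLocus_span]
  ext θ
  simp

/-- If p vanishes wherever q does not, then pq vanishes at every real point, so pq = 0 and p = 0. -/
theorem closure_zariski_aeval_ne_zero {σ : Type*} {q : MvPolynomial σ ℝ} (hq : q ≠ 0) :
    closure[zariskiTopology σ] {θ | MvPolynomial.aeval θ q ≠ 0} = Set.univ := by
  let _ := zariskiTopology σ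
  refine Set.eq_univ_of_forall fun θ => Set.mem_sInter.2 ?_
  rintro Z ⟨hZ, hU⟩
  obtain ⟨I, hI⟩ : ∃ I : Ideal (MvPolynomial σ ℝ), Zᶜᶜ = MvPolynomial.zeroLocus ℝ I :=
    (isOpen_compl_iff (s := Z)).2 hZ
  rw [compl_compl] at hI
  rw [hI, MvPolynomial.mem_zeroLocus_iff]
  intro p hp
  suffices p = 0 by rw [this, map_zero]
  refine (mul_eq_zero.1 (MvPolynomial.funext fun η => ?_ : p * q = 0)).resolve_right hq
  rw [map_mul, map_zero]
  by_cases hη : MvPolynomial.aeval η q = 0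
  · rw [← MvPolynomial.coe_aeval_eq_eval, RingHom.coe_coe, hη, mul_zero]
  · have hmem : η ∈ MvPolynomial.zeroLocus ℝ I := hI ▸ hU hη
    rw [← MvPolynomial.coe_aeval_eq_eval, RingHom.coe_coe,
      MvPolynomial.mem_zeroLocus_iff.1 hmem p hp, zero_mul]

/-- The weight of the `l`-th node with denominators cleared, as a polynomial in all parameters. -/
noncomputable def nodeWeightPoly (d n : ℕ) (l : Fin n) :
    MvPolynomial (Fin n ⊕ Fin (n - d)) ℝ :=
  ∑ i : Fin (n - d), MvPolynomial.X (Sum.inr i) *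
    ∑ s : Fin (d + 1), if windowIndex i s = l then
      ∏ k : Fin n, if k ∈ univ.image (windowIndex i) then 1
        else MvPolynomial.X (Sum.inl l) - MvPolynomial.X (Sum.inl k)
    else 0

/-- The full product over k ≠ l cancels the Lagrange denominators of each window containing l,
leaving only the factors outside that window. -/
theorem aeval_nodeWeightPoly {d n : ℕ} {θ : Params d n} (hx : Function.Injective (nodes θ))
    (l : Fin n) :
    MvPolynomial.aeval θ (nodeWeightPoly d n l) =
      nodeWeight (nodes θ) (amps θ) l *
        ∏ k, if k = l then 1 else nodes θ l - nodes θ k := by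
  simp only [nodeWeightPoly, map_sum, map_mul, MvPolynomial.aeval_X, nodeWeight, sum_mul, mul_assoc]
  refine sum_congr rfl fun i _ => congrArg (amps θ i * ·) (sum_congr rfl fun s _ => ?_)
  split_ifs with hl
  swap
  · simp
  subst hl
  have himg : ∏ k ∈ univ.image (windowIndex i),
      (if k = windowIndex i s then 1 else nodes θ (windowIndex i s) - nodes θ k) =
      ∏ t, if t = s then 1 else window (nodes θ) i s - window (nodes θ) i t := by
    rw [prod_image fun a _ b _ h => windowIndex_injective i h]
    refine prod_congr rfl fun t _ => ?_
    simp only [(windowIndex_injective i).eq_iff]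
    rfl
  have hcancel : lagrangeWeight (window (nodes θ) i) s *
      (∏ t, if t = s then 1 else window (nodes θ) i s - window (nodes θ) i t) = 1 := by
    rw [lagrangeWeight, ← prod_mul_distrib]
    refine prod_eq_one fun t _ => ?_
    split_ifs with h
    · exact one_mul 1
    · exact inv_mul_cancel₀ (sub_ne_zero.2 fun h' => h (window_injective hx i h').symm)
  rw [map_prod, ← prod_mul_prod_compl (univ.image (windowIndex i)),
    prod_eq_one (s := univ.image (windowIndex i)) fun k hk => by rw [if_pos hk, map_one], one_mul,
    ← prod_mul_prod_compl (univ.image (windowIndex i))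
      (fun k => if k = windowIndex i s then _ else _),
    himg, ← mul_assoc, hcancel, one_mul]
  refine prod_congr rfl fun k hk => ?_
  rw [mem_compl] at hk
  have hks : k ≠ windowIndex i s := fun h => hk (h ▸ mem_image_of_mem _ (mem_univ s))
  rw [if_neg hk, if_neg hks, map_sub, MvPolynomial.aeval_X, MvPolynomial.aeval_X]
  rfl

theorem prod_sub_nodes_ne_zero {n : ℕ} {x : Fin n → ℝ} (hx : Function.Injective x) (l : Fin n) :
    (∏ k, if k = l then 1 else x l - x k) ≠ 0 := by
  refine prod_ne_zero_iff.2 fun k _ => ?_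
  split_ifs with h
  · exact one_ne_zero
  · exact sub_ne_zero.2 fun h' => h (hx h').symm

theorem nodeWeightPoly_ne_zero {d n : ℕ} (hn : d + 1 ≤ n) (l : Fin n) :
    nodeWeightPoly d n l ≠ 0 := by
  -- Choose a window containing l: the one starting at l, or the last one when l is too close to the
  -- end. Putting the only amplitude there makes w_l a single Lagrange weight.
  have hmin : min l.1 (n - d - 1) < n - d := by omega
  set i₀ : Fin (n - d) := ⟨min l.1 (n - d - 1), hmin⟩ with hi₀
  set s₀ : Fin (d + 1) := ⟨l.1 - min l.1 (n - d - 1), by have := l.2; omega⟩ with hs₀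
  have hl : windowIndex i₀ s₀ = l := Fin.ext (by simp only [windowIndex, hi₀, hs₀]; omega)
  set θ : Params d n := Sum.elim (fun k => (k.1 : ℝ)) (Pi.single i₀ 1) with hθ
  have hx : Function.Injective (nodes θ) := fun a b h => by
    simpa [nodes, hθ, Fin.ext_iff] using h
  intro h0
  have h := aeval_nodeWeightPoly hx l
  rw [h0, map_zero] at h
  refine mul_ne_zero ?_ (prod_sub_nodes_ne_zero hx l) h.symm
  have hα : amps θ = Pi.single i₀ 1 := rfl
  rw [nodeWeight, hα, Fintype.sum_eq_single i₀ fun i hi => by rw [Pi.single_eq_of_ne hi, zero_mul],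
    Pi.single_eq_same, one_mul, Fintype.sum_eq_single s₀, if_pos hl]
  · exact lagrangeWeight_ne_zero (window_injective hx _) _
  · exact fun s hs => if_neg fun h' => hs (windowIndex_injective _ (h'.trans hl.symm))

/-- The polynomial whose nonvanishing locus consists of the parameters with distinct nodes,
nonzero amplitudes and nonzero weights at all nodes. -/
noncomputable def genericPoly (d n : ℕ) : MvPolynomial (Fin n ⊕ Fin (n - d)) ℝ :=
  (∏ l : Fin n, ∏ k : Fin n, if k = l then 1
      else MvPolynomial.X (Sum.inl l) - MvPolynomial.X (Sum.inl k)) *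
    (∏ i : Fin (n - d), MvPolynomial.X (Sum.inr i)) * ∏ l : Fin n, nodeWeightPoly d n l

theorem genericPoly_ne_zero {d n : ℕ} (hn : d + 1 ≤ n) : genericPoly d n ≠ 0 := by
  refine mul_ne_zero (mul_ne_zero ?_ ?_) ?_
  · refine prod_ne_zero_iff.2 fun l _ => prod_ne_zero_iff.2 fun k _ => ?_
    split_ifs with h
    · exact one_ne_zero
    · refine sub_ne_zero.2 fun h' => h ?_
      exact (Sum.inl_injective (MvPolynomial.X_injective h')).symm
  · exact prod_ne_zero_iff.2 fun i _ => MvPolynomial.X_ne_zero _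
  · exact prod_ne_zero_iff.2 fun l _ => nodeWeightPoly_ne_zero hn l

theorem aeval_genericPoly_ne_zero_iff {d n : ℕ} (θ : Params d n) :
    MvPolynomial.aeval θ (genericPoly d n) ≠ 0 ↔
      θ ∈ paramSpace d n ∧ ∀ l, nodeWeight (nodes θ) (amps θ) l ≠ 0 := by
  have hV : MvPolynomial.aeval θ (∏ l : Fin n, ∏ k : Fin n, if k = l then 1
      else MvPolynomial.X (Sum.inl l) - MvPolynomial.X (Sum.inl k) :
        MvPolynomial (Fin n ⊕ Fin (n - d)) ℝ) =
      ∏ l, ∏ k, if k = l then 1 else nodes θ l - nodes θ k := by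
    simp only [map_prod, apply_ite (MvPolynomial.aeval θ), map_one, map_sub, MvPolynomial.aeval_X]
    rfl
  rw [genericPoly, map_mul, map_mul, mul_ne_zero_iff, mul_ne_zero_iff, hV, map_prod, map_prod,
    prod_ne_zero_iff, prod_ne_zero_iff, prod_ne_zero_iff]
  simp only [MvPolynomial.aeval_X, mem_univ, forall_const]
  constructor
  · rintro ⟨⟨h1, h2⟩, h3⟩
    -- Distinctness is extracted first, since the cleared weights equal the true ones times a
    -- product only for distinct nodes.
    have hx : Function.Injective (nodes θ) := fun a b hab => by
      by_contra hne
      have := prod_ne_zero_iff.1 (h1 b) a (mem_univ a)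
      rw [if_neg hne, hab, sub_self] at this
      exact this rfl
    refine ⟨⟨hx, h2⟩, fun l h0 => h3 l ?_⟩
    rw [aeval_nodeWeightPoly hx, h0, zero_mul]
  · rintro ⟨⟨hx, h2⟩, h3⟩
    refine ⟨⟨fun l => prod_sub_nodes_ne_zero hx l, h2⟩, fun l => ?_⟩
    rw [aeval_nodeWeightPoly hx]
    exact mul_ne_zero (h3 l) (prod_sub_nodes_ne_zero hx l)

/-! ### Reconstruction -/

/-- The parameters with distinct nodes, nonzero amplitudes and nonzero weights at all nodes. -/
def genericSet (d n : ℕ) : Set (Params d n) :=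
  {θ | MvPolynomial.aeval θ (genericPoly d n) ≠ 0}

theorem mem_genericSet_iff {d n : ℕ} {θ : Params d n} :
    θ ∈ genericSet d n ↔ θ ∈ paramSpace d n ∧ ∀ l, nodeWeight (nodes θ) (amps θ) l ≠ 0 :=
  aeval_genericPoly_ne_zero_iff θ

theorem finrank_hankelKer_pronyMap {d n : ℕ} {θ : Params d n} (hθ : θ ∈ genericSet d n) :
    Module.finrank ℝ (hankelKer (pronyMap d n θ)) = 1 := by
  obtain ⟨⟨hx, -⟩, hw⟩ := mem_genericSet_iff.1 hθ
  exact finrank_hankelKer_splineMoments hx hw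

theorem roots_kernelPoly_pronyMap {d n : ℕ} {θ : Params d n} (hθ : θ ∈ genericSet d n)
    {u : Fin (n + 1) → ℝ} (hu : u ∈ hankelKer (pronyMap d n θ)) (hu0 : u ≠ 0) :
    (kernelPoly u).natDegree = n ∧ (kernelPoly u).roots = univ.val.map (nodes θ) := by
  obtain ⟨⟨hx, -⟩, hw⟩ := mem_genericSet_iff.1 hθ
  rw [pronyMap_eq_splineMoments, mem_hankelKer_splineMoments_iff hx] at hu
  exact roots_kernelPoly hu0 hx fun l => (mul_eq_zero.1 (hu l)).resolve_left (hw l)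

theorem ampMatrix_mulVec_eq_rhs_pronyMap_iff {d n : ℕ} {θ : Params d n}
    (hx : Function.Injective (nodes θ)) (a : Fin (n - d) → ℝ) :
    (ampMatrix d (nodes θ)).mulVec a = rhs (pronyMap d n θ) ↔ a = amps θ := by
  have h : amps θ = _ :=
    (mulVec_ampMatrix_eq_rhs_iff hx (pronyMap d n θ) (amps θ)).1 (rhs_splineMoments _ _).symm
  rw [mulVec_ampMatrix_eq_rhs_iff hx, ← h]

/-- One nonzero kernel vector serves both parameters, and its root multiset is each of the two node
lists. -/
theorem exists_perm_nodes {d n : ℕ} {θ θ' : Params d n} (hθ : θ ∈ genericSet d n)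
    (hθ' : θ' ∈ genericSet d n) (h : pronyMap d n θ = pronyMap d n θ') :
    ∃ τ : Equiv.Perm (Fin n), nodes θ' = nodes θ ∘ τ := by
  obtain ⟨v, hv0, -⟩ := finrank_eq_one_iff'.1 (finrank_hankelKer_pronyMap hθ)
  have hv0' : v.1 ≠ 0 := fun h0 => hv0 (Subtype.ext h0)
  have h1 := (roots_kernelPoly_pronyMap hθ v.2 hv0').2
  have h2 := (roots_kernelPoly_pronyMap hθ' (h ▸ v.2) hv0').2
  have hinj' := (mem_genericSet_iff.1 hθ').1.1
  have hmem : ∀ l, ∃ k, nodes θ k = nodes θ' l := by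
    intro l
    have : nodes θ' l ∈ univ.val.map (nodes θ) := by
      rw [← h1, h2]
      exact Multiset.mem_map_of_mem _ (mem_univ_val l)
    obtain ⟨k, -, hk⟩ := Multiset.mem_map.1 this
    exact ⟨k, hk⟩
  choose τ hτ using hmem
  have hτinj : Function.Injective τ := fun a b hab => hinj' (by rw [← hτ, ← hτ, hab])
  exact ⟨Equiv.ofBijective τ (Finite.injective_iff_bijective.1 hτinj), funext fun l => (hτ l).symm⟩

theorem eq_of_nodes_eq {d n : ℕ} {θ θ' : Params d n} (hx : Function.Injective (nodes θ))
    (h : pronyMap d n θ = pronyMap d n θ') (hnodes : nodes θ' = nodes θ) : θ' = θ := by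
  have hx' : Function.Injective (nodes θ') := hnodes ▸ hx
  have h1 := (ampMatrix_mulVec_eq_rhs_pronyMap_iff hx' (amps θ')).2 rfl
  rw [hnodes, ← h, ampMatrix_mulVec_eq_rhs_pronyMap_iff hx] at h1
  funext i
  rcases i with i | i
  · exact congrFun hnodes i
  · exact congrFun h1 i

/-- This gives uniqueness of the measure, and shows that a nonnegative representation can only be
the reconstructed one. -/
theorem amplitudes_eq_of_moments {d n : ℕ} {x : Fin n → ℝ} (hx : Function.Injective x)
    {M : Fin (2 * n - d) → ℝ} {β : Fin (n - d) → ℝ}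
    (h : ∀ j : Fin (2 * n - d), lineMoment (splineMeasure d x β) j.1 = M j) :
    β = (ampMatrix d x)⁻¹.mulVec (rhs M) := by
  rw [← mulVec_ampMatrix_eq_rhs_iff hx, ← rhs_splineMoments]
  congr 1
  funext j
  rw [← h j, lineMoment_splineMeasure hx, splineMoments]

theorem exists_eq_splineMeasure {d n : ℕ} {x : Fin n → ℝ} {ν : SignedMeasure ℝ}
    (hν : ν ∈ splineSpace d x) : ∃ β, ν = splineMeasure d x β := by
  obtain ⟨β, hβ⟩ := (Submodule.mem_span_range_iff_exists_fun ℝ).1 hν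
  exact ⟨β, hβ.symm⟩

end HigherProny

theorem mainTheorem4 (d n : ℕ) (hn : d + 1 ≤ n) :
    -- generic injectivity and the reconstruction procedure
    (∃ U : Set (Params d n),
      U ⊆ paramSpace d n ∧
      IsOpen[zariskiTopology (Fin n ⊕ Fin (n - d))] U ∧
      paramSpace d n ⊆ closure[zariskiTopology (Fin n ⊕ Fin (n - d))] U ∧
      -- injectivity under the ordering convention
      Set.InjOn (pronyMap d n) {θ | θ ∈ U ∧ StrictMono (nodes θ)} ∧
      -- without the convention: the nodes agree up to a permutation, and the ordered
      -- nodes determine the amplitudes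
      (∀ θ ∈ U, ∀ θ' ∈ U, pronyMap d n θ = pronyMap d n θ' →
        (∃ τ : Equiv.Perm (Fin n), nodes θ' = nodes θ ∘ τ) ∧
        (nodes θ' = nodes θ → θ' = θ)) ∧
      -- the three steps recover the nodes and the amplitudes
      (∀ θ ∈ U,
        Module.finrank ℝ (hankelKer (pronyMap d n θ)) = 1 ∧
        (∀ u ∈ hankelKer (pronyMap d n θ), u ≠ 0 →
          (kernelPoly u).natDegree = n ∧
          (kernelPoly u).roots = Finset.univ.val.map (nodes θ)) ∧
        IsUnit (ampMatrix d (nodes θ)).det ∧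
        (∀ a : Fin (n - d) → ℝ,
          (ampMatrix d (nodes θ)).mulVec a = rhs (pronyMap d n θ) ↔ a = amps θ))) ∧
    -- positivity for real data whose kernel polynomial has `n` simple real roots
    (∀ (M : Fin (2 * n - d) → ℝ) (u : Fin (n + 1) → ℝ) (x : Fin n → ℝ),
      Module.finrank ℝ (hankelKer M) = 1 → u ∈ hankelKer M → u ≠ 0 →
      StrictMono x → (kernelPoly u).roots = Finset.univ.val.map x →
      IsUnit (ampMatrix d x).det ∧
      -- the reconstructed measure is the unique spline measure with these moments
      (∀ j : Fin (2 * n - d),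
        lineMoment (splineMeasure d x ((ampMatrix d x)⁻¹.mulVec (rhs M))) j.1 = M j) ∧
      (∀ ν ∈ splineSpace d x, (∀ j : Fin (2 * n - d), lineMoment ν j.1 = M j) →
        ν = splineMeasure d x ((ampMatrix d x)⁻¹.mulVec (rhs M))) ∧
      -- and it is positive exactly when the `n - d` linear inequalities hold
      (splineMeasure d x ((ampMatrix d x)⁻¹.mulVec (rhs M)) ∈ positiveCone d x ↔
        ∀ i : Fin (n - d), 0 ≤ ((ampMatrix d x)⁻¹.mulVec (rhs M)) i)) := by
  constructor
  · refine ⟨genericSet d n, fun θ hθ => (mem_genericSet_iff.1 hθ).1,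
      isOpen_zariski_aeval_ne_zero _, ?_, ?_, ?_, ?_⟩
    · rw [genericSet, closure_zariski_aeval_ne_zero (genericPoly_ne_zero hn)]
      exact Set.subset_univ _
    · rintro θ ⟨hθ, hmono⟩ θ' ⟨hθ', hmono'⟩ h
      have hx := (mem_genericSet_iff.1 hθ).1.1
      obtain ⟨τ, hτ⟩ := exists_perm_nodes hθ hθ' h
      -- Two increasing enumerations of the same set coincide.
      have hrange : Set.range (nodes θ') = Set.range (nodes θ) := by
        rw [hτ, τ.surjective.range_comp]
      exact (eq_of_nodes_eq hx h (Set.range_injOn_strictMono hmono' hmono hrange)).symm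
    · exact fun θ hθ θ' hθ' h => ⟨exists_perm_nodes hθ hθ' h,
        eq_of_nodes_eq (mem_genericSet_iff.1 hθ).1.1 h⟩
    · intro θ hθ
      have hx := (mem_genericSet_iff.1 hθ).1.1
      exact ⟨finrank_hankelKer_pronyMap hθ, fun u hu hu0 => roots_kernelPoly_pronyMap hθ hu hu0,
        isUnit_det_ampMatrix hx, ampMatrix_mulVec_eq_rhs_pronyMap_iff hx⟩
  · intro M u x _ hu hu0 hmono hroots
    have hx := hmono.injective
    have hM := eq_splineMoments_of_roots hu hu0 hx hroots
    have hmom : ∀ j : Fin (2 * n - d),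
        lineMoment (splineMeasure d x ((ampMatrix d x)⁻¹.mulVec (rhs M))) j.1 = M j := by
      intro j
      rw [lineMoment_splineMeasure hx]
      exact congrFun hM j
    refine ⟨isUnit_det_ampMatrix hx, hmom, ?_, ?_⟩
    · intro ν hν h
      obtain ⟨β, rfl⟩ := exists_eq_splineMeasure hν
      rw [amplitudes_eq_of_moments hx h]
    · constructor
      · rintro ⟨β, hβ, he⟩
        rw [he] at hmom
        rw [← amplitudes_eq_of_moments hx hmom]
        exact hβ
      · exact fun h => ⟨_, h, rfl⟩
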